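/- Let $\Gamma$ be a torsion-free hyperbolic group, and let $G$ be a $\Gamma$-limit group, i.e. a finitely generated group such that for every finite set $S \subseteq G \setminus \{1\}$ there is a homomorphism $\phi : G \to \Gamma$ with $1 \notin \phi(S)$. For finite generating sets $X$ of $G$ and $Y$ of $\Gamma$, let $|\cdot|_X$ and $|\cdot|_Y$ denote the word lengths, and define the $\Gamma$-discriminating complexity of $G$ as the function $C : \mathbb{N} \to \mathbb{N}$ (where $0\in\mathbb{N}$), \[ C(R) = \min\Bigl\{ \max_{x \in X} |\phi(x)|_Y \;:\; \phi : G \to \Gamma \text{ a homomorphism with } \phi(g) \neq 1 \text{ for all } g \in G\setminus\{1\} \text{ with } |g|_X \leq R \Bigr\}. \] Let $n \geq 0$ be an integer, and suppose that $G$ contains a free abelian subgroup of rank $n+1$. Then, for all finite generating sets $X$ of $G$ and $Y$ of $\Gamma$, the function $C$ asymptotically dominates a polynomial of degree $n$: there are a polynomial $p$ of degree $n$ with coefficients in $\mathbb{N}$ and a constant $K \in \mathbb{N}$ such that \[ p(R) \leq K \, C(KR) + K \qquad \text{for all } R \in \mathbb{N}. \] -/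

import Mathlib

namespace LimitGroups

/-- The word length of `g` with respect to `X`: the least number of letters in a word
with letters in `X ∪ X⁻¹` that represents `g`, that is, the least number of edges in a path
from `1` to `g` in the Cayley graph. (Used only for generating sets `X`, where such words exist.) -/
noncomputable def wordLength {G : Type*} [Group G] (X : Set G) (g : G) : ℕ :=
  sInf {k : ℕ | ∃ l : List G, (∀ x ∈ l, x ∈ X ∨ x⁻¹ ∈ X) ∧ l.prod = g ∧ l.length = k}

/-- The word metric, i.e. the path metric on the vertices of the Cayley graph, whose edges join
`g` to `g * x` for `x ∈ X`. -/
noncomputable def wordDist {G : Type*} [Group G] (X : Set G) (g h : G) : ℕ :=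
  wordLength X (g⁻¹ * h)

/-- The closed ball of radius `R` about `1`. -/
def ball {G : Type*} [Group G] (X : Set G) (R : ℕ) : Set G :=
  {g : G | wordLength X g ≤ R}

/-- `X` is a finite generating set of the group `G`. -/
def IsFiniteGeneratingSet {G : Type*} [Group G] (X : Finset G) : Prop :=
  Subgroup.closure (X : Set G) = ⊤

/-- The restriction of `p` to `{0, …, L}` is the sequence of vertices of a geodesic of length `L`
from `a` to `b` in the Cayley graph. -/
def IsGeodesic {G : Type*} [Group G] (X : Set G) (a b : G) (L : ℕ) (p : ℕ → G) : Prop :=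
  p 0 = a ∧ p L = b ∧ ∀ i j : ℕ, i ≤ j → j ≤ L → wordDist X (p i) (p j) = j - i

/-- Thin triangles: each vertex of a side of a geodesic triangle in the Cayley graph is `δ`-close
to a vertex of one of the two other sides. As the triangle is arbitrary and geodesics can be
reversed, it suffices to say this for one of the sides. -/
def HasThinTriangles {G : Type*} [Group G] (X : Set G) (δ : ℕ) : Prop :=
  ∀ (a b c : G) (L M N : ℕ) (p q r : ℕ → G),
    IsGeodesic X a b L p → IsGeodesic X b c M q → IsGeodesic X a c N r →
    ∀ i ≤ L, (∃ j ≤ M, wordDist X (p i) (q j) ≤ δ) ∨ (∃ j ≤ N, wordDist X (p i) (r j) ≤ δ)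

/-- A (word-)hyperbolic group: a group with a finite generating set whose Cayley graph is
`δ`-hyperbolic for some `δ`. -/
def IsHyperbolicGroup (G : Type*) [Group G] : Prop :=
  ∃ X : Finset G, IsFiniteGeneratingSet X ∧ ∃ δ : ℕ, HasThinTriangles (X : Set G) δ

/-- No nontrivial element has finite order. -/
def IsTorsionFreeGroup (G : Type*) [Group G] : Prop :=
  ∀ g : G, g ≠ 1 → ¬ IsOfFinOrder g

/-- The homomorphism `φ` discriminates `S`: no element of `S` is mapped to `1`. -/
def Discriminates {G H : Type*} [Group G] [Group H] (φ : G →* H) (S : Set G) : Prop :=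
  ∀ s ∈ S, φ s ≠ 1

/-- `G` is fully residually `H`. -/
def IsFullyResidually (G H : Type*) [Group G] [Group H] : Prop :=
  ∀ S : Set G, S.Finite → 1 ∉ S → ∃ φ : G →* H, Discriminates φ S

/-- `G` is a `Γ`-limit group: finitely generated and fully residually `Γ`. -/
def IsLimitGroup (Γ G : Type*) [Group Γ] [Group G] : Prop :=
  Group.FG G ∧ IsFullyResidually G Γ

/-- The complexity of a homomorphism: the maximal `Y`-length of the image of an element of `X`. -/
noncomputable def homComplexity {G H : Type*} [Group G] [Group H] (X : Finset G) (Y : Finset H)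
    (φ : G →* H) : ℕ :=
  X.sup fun x => wordLength (Y : Set H) (φ x)

/-- The `H`-discriminating complexity of `G` with respect to `X` and `Y`: the minimal complexity of
a homomorphism `G → H` that discriminates the nontrivial elements of the ball of radius `R`. -/
noncomputable def discriminatingComplexity {G H : Type*} [Group G] [Group H] (X : Finset G)
    (Y : Finset H) (R : ℕ) : ℕ :=
  sInf {k : ℕ | ∃ φ : G →* H, Discriminates φ (ball (X : Set G) R \ {1}) ∧
    homComplexity X Y φ = k}

/-- `f ≼ g`: `f` is asymptotically dominated by `g`. -/
def AsymptoticallyDominatedBy (f g : ℕ → ℕ) : Prop :=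
  ∃ K : ℕ, ∀ R : ℕ, f R ≤ K * g (K * R) + K

/-- `G` has a free Abelian subgroup of rank `m`. -/
def HasFreeAbelianSubgroupOfRank (G : Type*) [Group G] (m : ℕ) : Prop :=
  ∃ A : Subgroup G, Nonempty (A ≃* Multiplicative (Fin m → ℤ))

end LimitGroups

/-! A homomorphism `φ` that discriminates a ball of radius `K * R` is injective on the box `{0, …,
R}ⁿ⁺¹` of the free abelian subgroup, once `K` is large. If `φ` has complexity `C`, the images are
`(R + 1) ^ (n + 1)` commuting elements of `Γ` of length `O(C * R)`. By `FourPoint.exists_card_le`,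
only `O(C * R + 1)` commuting elements of that length exist; dividing by `R + 1` bounds `R ^ n` by a
linear function of `C`.

This uniform linear growth rests on stable length. Nontrivial elements have stable length at least
some `1 / N` (`FourPoint.exists_stableLength_ge`). If `a` and `b` commute, then `a * b` or `a * b⁻¹`
has stable length at most the difference of those of `a` and `b` (`FourPoint.min_stableLength_le`).
So commuting elements whose stable lengths differ by less than `1 / N` are equal or inverse, and a
pigeonhole count finishes. -/

namespace LimitGroups

/-! ### Word lengths, finite balls and geodesics -/

section WordLength

variable {G : Type*} [Group G]

theorem wordLength_le_length {X : Set G} {l : List G} (hl : ∀ x ∈ l, x ∈ X ∨ x⁻¹ ∈ X) :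
    wordLength X l.prod ≤ l.length :=
  Nat.sInf_le ⟨l, hl, rfl, rfl⟩

theorem exists_word {X : Set G} (hX : Subgroup.closure X = ⊤) (g : G) :
    ∃ l : List G, (∀ x ∈ l, x ∈ X ∨ x⁻¹ ∈ X) ∧ l.prod = g ∧ l.length = wordLength X g := by
  have hg : g ∈ Submonoid.closure (X ∪ X⁻¹) := by
    rw [← Subgroup.closure_toSubmonoid, hX]
    trivial
  obtain ⟨l, hl, hg⟩ := Submonoid.exists_list_of_mem_closure hg
  exact Nat.sInf_mem (s := {k : ℕ | ∃ l : List G, (∀ x ∈ l, x ∈ X ∨ x⁻¹ ∈ X) ∧ l.prod = g ∧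
    l.length = k}) ⟨l.length, l, hl, hg, rfl⟩

@[simp] theorem wordLength_one (X : Set G) : wordLength X 1 = 0 := by
  simpa using wordLength_le_length (X := X) (l := []) (by simp)

theorem wordLength_mul_le {X : Set G} (hX : Subgroup.closure X = ⊤) (g h : G) :
    wordLength X (g * h) ≤ wordLength X g + wordLength X h := by
  obtain ⟨l, hl, rfl, hl'⟩ := exists_word hX g
  obtain ⟨m, hm, rfl, hm'⟩ := exists_word hX h
  rw [← hl', ← hm', ← List.prod_append, ← List.length_append]
  refine wordLength_le_length fun x hx => ?_
  rcases List.mem_append.1 hx with hx | hx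
  exacts [hl x hx, hm x hx]

theorem wordLength_inv_le {X : Set G} (hX : Subgroup.closure X = ⊤) (g : G) :
    wordLength X g⁻¹ ≤ wordLength X g := by
  obtain ⟨l, hl, rfl, hl'⟩ := exists_word hX g
  rw [← hl', List.prod_inv_reverse]
  refine (wordLength_le_length fun x hx => ?_).trans (by simp)
  simp only [List.mem_reverse, List.mem_map] at hx
  obtain ⟨y, hy, rfl⟩ := hx
  rw [inv_inv]
  exact (hl y hy).symm

theorem wordLength_inv {X : Set G} (hX : Subgroup.closure X = ⊤) (g : G) :
    wordLength X g⁻¹ = wordLength X g :=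
  le_antisymm (wordLength_inv_le hX g) (by simpa using wordLength_inv_le hX g⁻¹)

theorem wordDist_comm {X : Set G} (hX : Subgroup.closure X = ⊤) (g h : G) :
    wordDist X g h = wordDist X h g := by
  rw [wordDist, wordDist, ← wordLength_inv hX]
  simp

theorem wordDist_triangle {X : Set G} (hX : Subgroup.closure X = ⊤) (a b c : G) :
    wordDist X a c ≤ wordDist X a b + wordDist X b c := by
  have := wordLength_mul_le hX (a⁻¹ * b) (b⁻¹ * c)
  rwa [show a⁻¹ * b * (b⁻¹ * c) = a⁻¹ * c by group] at this

theorem wordDist_mul_left (X : Set G) (g a b : G) :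
    wordDist X (g * a) (g * b) = wordDist X a b := by
  simp [wordDist, mul_assoc]

theorem finite_ball {X : Finset G} (hX : Subgroup.closure (X : Set G) = ⊤) (R : ℕ) :
    (ball (X : Set G) R).Finite := by
  classical
  let Z : Set G := X ∪ (X : Set G)⁻¹
  have hZ : Z.Finite := X.finite_toSet.union X.finite_toSet.inv
  have : Finite Z := hZ
  refine (((List.finite_length_le Z R).image fun l => (l.map Subtype.val).prod)).subset ?_
  intro g hg
  obtain ⟨l, hl, hlg, hl'⟩ := exists_word hX g
  have hlZ : ∀ x ∈ l, x ∈ Z := fun x hx => hl x hx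
  refine ⟨l.attach.map fun x => ⟨x.1, hlZ x.1 x.2⟩, ?_, ?_⟩
  · simpa [hl', ball] using hg
  · simp [List.map_map, Function.comp_def, hlg]

theorem wordLength_map_le {H : Type*} [Group H] {X : Finset G} {Y : Finset H}
    (hX : Subgroup.closure (X : Set G) = ⊤) (hY : Subgroup.closure (Y : Set H) = ⊤)
    (φ : G →* H) (g : G) :
    wordLength (Y : Set H) (φ g) ≤ homComplexity X Y φ * wordLength (X : Set G) g := by
  obtain ⟨l, hl, rfl, hl'⟩ := exists_word hX g
  rw [← hl']
  clear hl'
  induction l with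
  | nil => simp
  | cons x l ih =>
    have hx : wordLength (Y : Set H) (φ x) ≤ homComplexity X Y φ := by
      rcases hl x (by simp) with h | h
      · exact Finset.le_sup (f := fun x => wordLength (Y : Set H) (φ x)) (by exact_mod_cast h)
      · rw [← wordLength_inv hY, ← map_inv]
        exact Finset.le_sup (f := fun x => wordLength (Y : Set H) (φ x)) (by exact_mod_cast h)
    have := ih fun y hy => hl y (by simp [hy])
    rw [List.prod_cons, map_mul, List.length_cons, mul_add, mul_one]
    have := wordLength_mul_le hY (φ x) (φ l.prod)
    omega

theorem exists_isGeodesic {X : Set G} (hX : Subgroup.closure X = ⊤) (a b : G) :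
    ∃ p : ℕ → G, IsGeodesic X a b (wordDist X a b) p := by
  obtain ⟨l, hl, hlg, hl'⟩ := exists_word hX (a⁻¹ * b)
  have hlen : l.length = wordDist X a b := hl'
  have h0 : a * (l.take 0).prod = a := by simp
  have h1 : a * (l.take l.length).prod = b := by simp [hlg]
  have key : ∀ i j : ℕ, i ≤ j → j ≤ l.length →
      wordDist X (a * (l.take i).prod) (a * (l.take j).prod) ≤ j - i := by
    intro i j hij hj
    have : (l.take j).prod = (l.take i).prod * ((l.take j).drop i).prod := by
      rw [← List.prod_append]
      congr 1
      conv_lhs => rw [← List.take_append_drop i (l.take j)]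
      rw [List.take_take, min_eq_left hij]
    rw [wordDist_mul_left, wordDist, this, inv_mul_cancel_left]
    refine (wordLength_le_length fun x hx => hl x ?_).trans
      (by rw [List.length_drop, List.length_take]; omega)
    exact List.mem_of_mem_take (List.mem_of_mem_drop hx)
  refine ⟨fun i => a * (l.take i).prod, h0, by rw [← hlen]; exact h1, fun i j hij hj => ?_⟩
  rw [← hlen] at hj
  -- The upper bounds for the three segments add up to the distance of the endpoints, so each is
  -- attained.
  have e1 := key 0 i (Nat.zero_le _) (hij.trans hj)
  have e2 := key i j hij hj
  have e3 := key j l.length hj le_rfl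
  rw [h0] at e1
  rw [h1] at e3
  have t1 := wordDist_triangle hX a (a * (l.take i).prod) b
  have t2 := wordDist_triangle hX (a * (l.take i).prod) (a * (l.take j).prod) b
  show wordDist X (a * (l.take i).prod) (a * (l.take j).prod) = j - i
  omega

end WordLength

/-! ### From thin triangles to the four-point inequality -/

section FourPoint

variable {G : Type*} [Group G]

/-- Gromov's four-point inequality for the word metric, with error term `D`. -/
def FourPoint (X : Set G) (D : ℕ) : Prop :=
  ∀ x y z w : G, wordDist X x z + wordDist X y w ≤
    max (wordDist X x y + wordDist X z w) (wordDist X y z + wordDist X x w) + D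

theorem IsGeodesic.dist_left {X : Set G} {a b : G} {L : ℕ} {p : ℕ → G} (hp : IsGeodesic X a b L p)
    {i : ℕ} (hi : i ≤ L) : wordDist X a (p i) = i := by
  simpa [hp.1] using hp.2.2 0 i (Nat.zero_le _) hi

theorem IsGeodesic.dist_right {X : Set G} {a b : G} {L : ℕ} {p : ℕ → G}
    (hp : IsGeodesic X a b L p) {i : ℕ} (hi : i ≤ L) : wordDist X (p i) b = L - i := by
  simpa [hp.2.1] using hp.2.2 i L hi le_rfl

/-- In a thin triangle, a side comes close to the opposite vertex, within the Gromov product. -/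
theorem HasThinTriangles.exists_close_vertex {X : Set G} (hX : Subgroup.closure X = ⊤) {δ : ℕ}
    (h : HasThinTriangles X δ) (w x y : G) {p : ℕ → G}
    (hp : IsGeodesic X x y (wordDist X x y) p) :
    ∃ i ≤ wordDist X x y,
      2 * wordDist X w (p i) + wordDist X x y ≤
        wordDist X w x + wordDist X w y + 4 * δ + 2 := by
  obtain ⟨q, hq⟩ := exists_isGeodesic hX y w
  obtain ⟨r, hr⟩ := exists_isGeodesic hX x w
  set L := wordDist X x y
  have hleft : ∀ i ≤ L, (∃ j ≤ wordDist X x w, wordDist X (p i) (r j) ≤ δ) →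
      wordDist X w (p i) + i ≤ wordDist X w x + 2 * δ := by
    rintro i hi ⟨j, hj, hd⟩
    have e1 := hp.dist_left hi
    have e2 := hr.dist_left hj
    have e3 := hr.dist_right hj
    have t1 := wordDist_triangle hX x (r j) (p i)
    have t2 := wordDist_triangle hX w (r j) (p i)
    rw [wordDist_comm hX (r j) (p i)] at t1 t2
    rw [wordDist_comm hX w (r j)] at t2
    rw [wordDist_comm hX w x]
    omega
  have hright : ∀ i ≤ L, (∃ j ≤ wordDist X y w, wordDist X (p i) (q j) ≤ δ) →
      wordDist X w (p i) + (L - i) ≤ wordDist X w y + 2 * δ := by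
    rintro i hi ⟨j, hj, hd⟩
    have e1 := hp.dist_right hi
    have e2 := hq.dist_left hj
    have e3 := hq.dist_right hj
    have t1 := wordDist_triangle hX y (q j) (p i)
    have t2 := wordDist_triangle hX w (q j) (p i)
    rw [wordDist_comm hX (q j) (p i)] at t1 t2
    rw [wordDist_comm hX w (q j)] at t2
    rw [wordDist_comm hX y (p i)] at t1
    rw [wordDist_comm hX w y]
    omega
  classical
  -- At the first vertex `p k` close to the side `y w` (or at the end `y`), `hright` applies. Its
  -- predecessor is close to `x w`, so `hleft` applies there; the unit step between them costs the
  -- final `2`.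
  have hex : ∃ i, i = L ∨ ∃ j ≤ wordDist X y w, wordDist X (p i) (q j) ≤ δ := ⟨L, .inl rfl⟩
  have hmin := fun m => Nat.find_min hex (m := m)
  have hspec := Nat.find_spec hex
  set k := Nat.find hex
  have hkL : k ≤ L := Nat.find_min' hex (.inl rfl)
  have hR : wordDist X w (p k) + (L - k) ≤ wordDist X w y + 2 * δ := by
    rcases hspec with hk | hk
    · rw [hk, hp.2.1]; omega
    · exact hright k hkL hk
  refine ⟨k, hkL, ?_⟩
  rcases Nat.eq_zero_or_pos k with hk | hk
  · rw [hk, hp.1] at hR ⊢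
    omega
  · have h1 := hmin (k - 1) (by omega)
    push Not at h1
    have h2 : ∃ j ≤ wordDist X x w, wordDist X (p (k - 1)) (r j) ≤ δ := by
      rcases h x y w _ _ _ p q r hp hq hr (k - 1) (by omega) with ⟨j, hj, hd⟩ | h2
      · exact absurd hd (by have := h1.2 j hj; omega)
      · exact h2
    have hL := hleft (k - 1) (by omega) h2
    have e := hp.2.2 (k - 1) k (by omega) hkL
    have t := wordDist_triangle hX w (p (k - 1)) (p k)
    omega

theorem IsGeodesic.gromov_product_le {X : Set G} (hX : Subgroup.closure X = ⊤) {x y : G} {L : ℕ}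
    {p : ℕ → G} (hp : IsGeodesic X x y L p) (w : G) {i : ℕ} (hi : i ≤ L) :
    wordDist X w x + wordDist X w y ≤ 2 * wordDist X w (p i) + L := by
  have e1 := hp.dist_left hi
  have e2 := hp.dist_right hi
  have t1 := wordDist_triangle hX w (p i) x
  have t2 := wordDist_triangle hX w (p i) y
  rw [wordDist_comm hX (p i) x] at t1
  omega

/-- A vertex on the side `x z` nearly realizes the Gromov product at `w` (error `4 * δ + 2`). It is
`δ`-close to another side, whose Gromov product is therefore not much larger (error `2 * δ`). -/
theorem HasThinTriangles.fourPoint {X : Set G} (hX : Subgroup.closure X = ⊤) {δ : ℕ}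
    (h : HasThinTriangles X δ) : FourPoint X (6 * δ + 2) := by
  intro x y z w
  obtain ⟨p, hp⟩ := exists_isGeodesic hX x z
  obtain ⟨q, hq⟩ := exists_isGeodesic hX z y
  obtain ⟨r, hr⟩ := exists_isGeodesic hX x y
  obtain ⟨i, hi, hd⟩ := h.exists_close_vertex hX w x z hp
  rw [wordDist_comm hX y w, wordDist_comm hX z w, wordDist_comm hX x w, wordDist_comm hX y z]
  rcases h x z y _ _ _ p q r hp hq hr i hi with ⟨j, hj, hd'⟩ | ⟨j, hj, hd'⟩
  · have := hq.gromov_product_le hX w hj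
    have t := wordDist_triangle hX w (p i) (q j)
    omega
  · have := hr.gromov_product_le hX w hj
    have t := wordDist_triangle hX w (p i) (r j)
    omega

end FourPoint


/-! ### Stable length, in particular of commuting elements -/

section StableLength

open Filter Topology

variable {G : Type*} [Group G]

/-- The stable length (stable translation length) `lim |g ^ n| / n`. -/
noncomputable def stableLength (X : Set G) (g : G) : ℝ :=
  limUnder atTop fun n : ℕ => (wordLength X (g ^ n) : ℝ) / n

theorem subadditive_wordLength_pow {X : Set G} (hX : Subgroup.closure X = ⊤) (g : G) :
    Subadditive fun n : ℕ => (wordLength X (g ^ n) : ℝ) := by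
  intro m n
  simp only [pow_add]
  exact_mod_cast wordLength_mul_le hX _ _

theorem bddBelow_wordLength_pow_div (X : Set G) (g : G) :
    BddBelow (Set.range fun n : ℕ => (wordLength X (g ^ n) : ℝ) / n) :=
  ⟨0, by rintro _ ⟨n, rfl⟩; positivity⟩

theorem tendsto_stableLength {X : Set G} (hX : Subgroup.closure X = ⊤) (g : G) :
    Tendsto (fun n : ℕ => (wordLength X (g ^ n) : ℝ) / n) atTop (𝓝 (stableLength X g)) :=
  tendsto_nhds_limUnder
    ⟨_, (subadditive_wordLength_pow hX g).tendsto_lim (bddBelow_wordLength_pow_div X g)⟩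

theorem stableLength_nonneg {X : Set G} (hX : Subgroup.closure X = ⊤) (g : G) :
    0 ≤ stableLength X g :=
  ge_of_tendsto' (tendsto_stableLength hX g) fun n => by positivity

theorem stableLength_le {X : Set G} (hX : Subgroup.closure X = ⊤) (g : G) :
    stableLength X g ≤ wordLength X g := by
  have h := subadditive_wordLength_pow hX g
  have hb := bddBelow_wordLength_pow_div X g
  rw [tendsto_nhds_unique (tendsto_stableLength hX g) (h.tendsto_lim hb)]
  simpa using h.lim_le_div hb one_ne_zero

theorem stableLength_pow {X : Set G} (hX : Subgroup.closure X = ⊤) (g : G) (k : ℕ) :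
    stableLength X (g ^ k) = k * stableLength X g := by
  refine tendsto_nhds_unique (tendsto_stableLength hX (g ^ k)) ?_
  rcases Nat.eq_zero_or_pos k with rfl | hk
  · simp
  have h := (tendsto_stableLength hX g).comp
    (tendsto_id.const_mul_atTop' (r := k) hk : Tendsto (fun n : ℕ => k * n) atTop atTop)
  refine (h.const_mul (k : ℝ)).congr fun n => ?_
  have : (k : ℝ) ≠ 0 := by positivity
  simp only [Function.comp, pow_mul, Nat.cast_mul]
  rw [← mul_div_assoc, mul_div_mul_left _ _ this]

theorem stableLength_conj {X : Set G} (hX : Subgroup.closure X = ⊤) (g x : G) :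
    stableLength X (x⁻¹ * g * x) ≤ stableLength X g := by
  have h : Tendsto (fun n : ℕ => (wordLength X (g ^ n) : ℝ) / n + (2 * wordLength X x : ℝ) / n)
      atTop (𝓝 (stableLength X g + 0)) :=
    (tendsto_stableLength hX g).add (tendsto_const_div_atTop_nhds_zero_nat _)
  rw [add_zero] at h
  refine le_of_tendsto_of_tendsto' (tendsto_stableLength hX _) h fun n => ?_
  rw [← add_div]
  gcongr
  have e : (x⁻¹ * g * x) ^ n = x⁻¹ * g ^ n * x := by
    simpa using (conj_pow (a := x⁻¹) (b := g) (i := n))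
  rw [e]
  have h1 := wordLength_mul_le hX (x⁻¹ * g ^ n) x
  have h2 := wordLength_mul_le hX x⁻¹ (g ^ n)
  rw [wordLength_inv hX] at h2
  have : wordLength X (x⁻¹ * g ^ n * x) ≤ wordLength X (g ^ n) + 2 * wordLength X x := by omega
  exact_mod_cast this

/-- In a hyperbolic group, `|g²| - |g|` is a lower bound for the stable length, up to a constant. -/
theorem FourPoint.wordLength_sq_le {X : Set G} (hX : Subgroup.closure X = ⊤) {D : ℕ}
    (h : FourPoint X D) {g : G} (hg : stableLength X g ≤ 1) :
    wordLength X (g ^ 2) ≤ wordLength X g + D + 1 := by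
  by_contra! hlt
  -- If the square is too long, the four-point inequality propagates growth by at least `2` to all
  -- powers, forcing stable length at least `2`.
  have step : ∀ n : ℕ, wordLength X (g ^ n) + 2 ≤ wordLength X (g ^ (n + 1)) := by
    intro n
    induction n with
    | zero =>
      have := wordLength_mul_le hX g g
      rw [pow_two] at hlt
      simp
      omega
    | succ n ih =>
      have key := h 1 g (g ^ 2) (g ^ (n + 2))
      have e1 : g⁻¹ * g ^ (n + 2) = g ^ (n + 1) := by group
      have e2 : (g ^ 2)⁻¹ * g ^ (n + 2) = g ^ n := by group
      have e3 : g⁻¹ * g ^ 2 = g := by group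
      simp only [wordDist, inv_one, one_mul, e1, e2, e3] at key
      show wordLength X (g ^ (n + 1)) + 2 ≤ wordLength X (g ^ (n + 2))
      omega
  have lin : ∀ n : ℕ, 2 * n ≤ wordLength X (g ^ n) := by
    intro n
    induction n with
    | zero => simp
    | succ n ih => have := step n; omega
  have : (2 : ℝ) ≤ stableLength X g := by
    refine ge_of_tendsto (tendsto_stableLength hX g) ?_
    filter_upwards [eventually_gt_atTop 0] with n hn
    rw [le_div_iff₀ (by positivity)]
    exact_mod_cast lin n
  linarith

/-- The four-point inequality for the parallelogram `1, a, a * b, b`, whose opposite sides have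
equal length because `a` and `b` commute. -/
theorem FourPoint.wordLength_commute {X : Set G} (hX : Subgroup.closure X = ⊤) {D : ℕ}
    (h : FourPoint X D) {a b : G} (hab : Commute a b) :
    wordLength X (a * b) + wordLength X (a * b⁻¹) ≤
        max (2 * wordLength X a) (2 * wordLength X b) + D ∧
      2 * wordLength X a ≤
        max (wordLength X (a * b) + wordLength X (a * b⁻¹)) (2 * wordLength X b) + D := by
  have e1 : a⁻¹ * (a * b) = b := by group
  have e2 : b⁻¹ * (a * b) = a := by rw [hab.eq]; group
  have e3 : wordLength X (a⁻¹ * b) = wordLength X (a * b⁻¹) := by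
    rw [← wordLength_inv hX, mul_inv_rev, inv_inv, (hab.inv_right).eq]
  have k1 := h 1 a (a * b) b
  have k2 := h 1 (a * b) a b
  have e5 : (a * b)⁻¹ * a = b⁻¹ := by rw [mul_inv_rev, inv_mul_cancel_right]
  have e6 : (a * b)⁻¹ * b = a⁻¹ := by rw [hab.eq, mul_inv_rev, inv_mul_cancel_right]
  simp only [wordDist, inv_one, one_mul, e1, mul_inv_rev, e3] at k1 k2
  rw [← mul_inv_rev] at k1 k2
  rw [e6, wordLength_inv hX] at k1 k2
  rw [e5, wordLength_inv hX] at k2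
  omega

theorem FourPoint.stableLength_commute {X : Set G} (hX : Subgroup.closure X = ⊤) {D : ℕ}
    (h : FourPoint X D) {a b : G} (hab : Commute a b) :
    stableLength X (a * b) + stableLength X (a * b⁻¹) ≤
        max (2 * stableLength X a) (2 * stableLength X b) ∧
      2 * stableLength X a ≤
        max (stableLength X (a * b) + stableLength X (a * b⁻¹)) (2 * stableLength X b) := by
  have ta := (tendsto_stableLength hX a).const_mul 2
  have tb := (tendsto_stableLength hX b).const_mul 2
  have tm := (tendsto_stableLength hX (a * b)).add (tendsto_stableLength hX (a * b⁻¹))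
  have tD := tendsto_const_div_atTop_nhds_zero_nat (D : ℝ)
  have key := fun n : ℕ => h.wordLength_commute hX (hab.pow_pow n n)
  have hm : ∀ n : ℕ, (a * b) ^ n = a ^ n * b ^ n := fun n => hab.mul_pow n
  have hi : ∀ n : ℕ, (a * b⁻¹) ^ n = a ^ n * (b ^ n)⁻¹ := fun n => by
    rw [hab.inv_right.mul_pow, inv_pow]
  constructor
  · rw [← add_zero (max _ _)]
    refine le_of_tendsto_of_tendsto' tm ((ta.max tb).add tD) fun n => ?_
    have := (key n).1
    rw [hm, hi]
    rw [← mul_div_assoc, ← mul_div_assoc, max_div_div_right (by positivity), ← add_div, ← add_div]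
    refine div_le_div_of_nonneg_right ?_ (by positivity)
    exact_mod_cast this
  · rw [← add_zero (max _ _)]
    refine le_of_tendsto_of_tendsto' ta ((tm.max tb).add tD) fun n => ?_
    have := (key n).2
    rw [hm, hi]
    rw [← mul_div_assoc, ← mul_div_assoc, ← add_div, max_div_div_right (by positivity), ← add_div]
    gcongr
    exact_mod_cast this

theorem stableLength_inv {X : Set G} (hX : Subgroup.closure X = ⊤) (g : G) :
    stableLength X g⁻¹ = stableLength X g := by
  simp only [stableLength, inv_pow, wordLength_inv hX]

/-- On commuting elements of a hyperbolic group, the stable length behaves like the absolute value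
of a homomorphism to `ℝ`. -/
theorem FourPoint.min_stableLength_le {X : Set G} (hX : Subgroup.closure X = ⊤) {D : ℕ}
    (h : FourPoint X D) {a b : G} (hab : Commute a b) :
    min (stableLength X (a * b)) (stableLength X (a * b⁻¹)) ≤
      |stableLength X a - stableLength X b| := by
  have hc : Commute (a * b) (a * b⁻¹) :=
    ((Commute.refl a).mul_left hab.symm).mul_right
      (hab.inv_right.mul_left (Commute.refl b).inv_right)
  obtain ⟨p1, p2⟩ := h.stableLength_commute hX hab
  obtain ⟨-, p3⟩ := h.stableLength_commute hX hab.symm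
  obtain ⟨q1, q2⟩ := h.stableLength_commute hX hc
  obtain ⟨-, q3⟩ := h.stableLength_commute hX hc.symm
  have e1 : a * b * (a * b⁻¹) = a ^ 2 := by
    rw [mul_assoc, ← mul_assoc b, ← hab.eq, mul_assoc a b, mul_inv_cancel, mul_one, pow_two]
  have e2 : a * b * (a * b⁻¹)⁻¹ = b ^ 2 := by
    rw [mul_inv_rev, inv_inv, hab.eq, pow_two, ← mul_assoc, mul_assoc b a, mul_assoc b,
      hab.eq, mul_assoc, mul_inv_cancel, mul_one]
  have e3 : a * b⁻¹ * (a * b) = a ^ 2 := by rw [← hc.eq, e1]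
  have e4 : stableLength X (a * b⁻¹ * (a * b)⁻¹) = 2 * stableLength X b := by
    rw [← stableLength_inv hX, mul_inv_rev, inv_inv, e2, stableLength_pow hX]; norm_num
  have e5 : stableLength X (a ^ 2) = 2 * stableLength X a := by
    rw [stableLength_pow hX]; norm_num
  have e6 : stableLength X (b ^ 2) = 2 * stableLength X b := by
    rw [stableLength_pow hX]; norm_num
  have e7 : stableLength X (b * a⁻¹) = stableLength X (a * b⁻¹) := by
    rw [← stableLength_inv hX, mul_inv_rev, inv_inv]
  rw [e1, e2, e5, e6] at q1 q2
  rw [e3, e4, e5] at q3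
  rw [e7, ← hab.eq] at p3
  have na := stableLength_nonneg hX a
  have nb := stableLength_nonneg hX b
  have nu := stableLength_nonneg hX (a * b)
  have nv := stableLength_nonneg hX (a * b⁻¹)
  generalize stableLength X a = p at *
  generalize stableLength X b = q at *
  generalize stableLength X (a * b) = u at *
  generalize stableLength X (a * b⁻¹) = v at *
  clear hc e1 e2 e3 e4 e5 e6 e7
  -- The claim follows from `u + v ≤ 2 * max p q` and, from the pair `a * b`, `a * b⁻¹`, `p + q ≤
  -- max u v`.
  grind

end StableLength

/-! ### The stable length gap and linear growth of commuting sets -/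

section Displacement

variable {G : Type*} [Group G]

theorem exists_wordLength_eq {X : Set G} (hX : Subgroup.closure X = ⊤) (g : G) {r : ℕ}
    (hr : r ≤ wordLength X g) :
    ∃ y, wordLength X y = r ∧ wordLength X (y⁻¹ * g) = wordLength X g - r := by
  obtain ⟨p, hp⟩ := exists_isGeodesic hX 1 g
  have e : wordDist X 1 g = wordLength X g := by simp [wordDist]
  rw [e] at hp
  refine ⟨p r, ?_, hp.dist_right hr⟩
  simpa [wordDist] using hp.dist_left hr

/-- If all powers of `g` up to the `N`-th have small stable length, then, after a
conjugation, they lie in a ball whose radius depends on the hyperbolicity constant only. -/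
theorem FourPoint.exists_conj_pow_mem_ball {X : Set G} (hX : Subgroup.closure X = ⊤) {D : ℕ}
    (h : FourPoint X D) {g : G} {N : ℕ} (hg : ∀ i ≤ N, stableLength X (g ^ i) ≤ 1) :
    ∃ x, ∀ i ≤ N, (x⁻¹ * g * x) ^ i ∈ ball X (8 * D + 4) := by
  classical
  let M : G → ℕ := fun x => (Finset.range (N + 1)).sup fun i => wordLength X ((x⁻¹ * g * x) ^ i)
  -- The conjugator minimizes the largest displacement among the powers; if that were large, moving
  -- the base point would reduce it.
  obtain ⟨x, hx⟩ : ∃ x, ∀ y, M x ≤ M y := by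
    obtain ⟨x, hx⟩ := Nat.sInf_mem (Set.range_nonempty M)
    exact ⟨x, fun y => hx ▸ Nat.sInf_le ⟨y, rfl⟩⟩
  have hle : ∀ i ≤ N, wordLength X ((x⁻¹ * g * x) ^ i) ≤ M x := fun i hi =>
    Finset.le_sup (f := fun i => wordLength X ((x⁻¹ * g * x) ^ i))
      (Finset.mem_range.2 (by omega))
  obtain ⟨j, hj, hjM⟩ := Finset.exists_mem_eq_sup (Finset.range (N + 1)) (by simp)
    (fun i => wordLength X ((x⁻¹ * g * x) ^ i))
  replace hj : j ≤ N := by simpa [Nat.lt_succ_iff] using hj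
  change M x = wordLength X ((x⁻¹ * g * x) ^ j) at hjM
  refine ⟨x, fun i hi => (hle i hi).trans ?_⟩
  by_contra! hlt
  have hsq : ∀ i ≤ N, wordLength X ((x⁻¹ * g * x) ^ i * (x⁻¹ * g * x) ^ i) ≤
      wordLength X ((x⁻¹ * g * x) ^ i) + D + 1 := by
    intro i hi
    rw [← pow_two]
    refine h.wordLength_sq_le hX ?_
    have e : (x⁻¹ * g * x) ^ i = x⁻¹ * g ^ i * x := by
      simpa using (conj_pow (a := x⁻¹) (b := g) (i := i))
    rw [e]
    exact (stableLength_conj hX _ _).trans (hg i hi)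
  -- The base point moves by `r = 2 * D + 1` towards the longest power. The radius `8 * D + 4` is `4
  -- * r`.
  obtain ⟨y, hy, hy'⟩ := exists_wordLength_eq hX ((x⁻¹ * g * x) ^ j) (r := 2 * D + 1) (by omega)
  have hMy : M (x * y) < M x := by
    refine (Finset.sup_lt_iff (by simp only [bot_eq_zero]; omega)).2 fun i hi => ?_
    replace hi : i ≤ N := by simpa [Nat.lt_succ_iff] using hi
    have e : ((x * y)⁻¹ * g * (x * y)) ^ i = y⁻¹ * (x⁻¹ * g * x) ^ i * y := by
      have : (x * y)⁻¹ * g * (x * y) = y⁻¹ * (x⁻¹ * g * x) * y := by group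
      rw [this]
      simpa using (conj_pow (a := y⁻¹) (b := x⁻¹ * g * x) (i := i))
    rw [e]
    have hdiff : wordLength X (((x⁻¹ * g * x) ^ j)⁻¹ * (x⁻¹ * g * x) ^ i) ≤ M x := by
      rcases le_total i j with hij | hij
      · rw [← wordLength_inv hX, mul_inv_rev, inv_inv]
        have := hle (j - i) (by omega)
        rwa [pow_sub _ hij, (Commute.pow_pow_self _ _ _).inv_right.eq] at this
      · have := hle (i - j) (by omega)
        rwa [pow_sub _ hij, (Commute.pow_pow_self _ _ _).inv_right.eq] at this
    have hii := hle i hi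
    have hs := hsq i hi
    set k := x⁻¹ * g * x
    by_cases hsmall : wordLength X (k ^ i) + 2 * (2 * D + 1) + 1 ≤ M x
    · have t1 := wordLength_mul_le hX (y⁻¹ * k ^ i) y
      have t2 := wordLength_mul_le hX y⁻¹ (k ^ i)
      rw [wordLength_inv hX] at t2
      omega
    -- Now `k ^ i` is longer than `2 * r`. By `f1`, `y` is closer to `k ^ i` than `1` is, by `r -
    -- D`. By `f2` and the bound on squares, its distance to `(k ^ i)⁻¹` is controlled too. Then
    -- `f3` bounds the new displacement by `max (4 * D + 1) (|k ^ i| - 2)`, below `M x`.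
    have f1 := h y 1 (k ^ i) (k ^ j)
    have f2 := h y 1 (k ^ i)⁻¹ (k ^ i)
    have f3 := h y 1 (k ^ i * y) (k ^ i)
    rw [wordDist_comm hX (k ^ i)] at f1
    have g1 : wordDist X (k ^ i * y) (k ^ i) = wordLength X y := by
      simp [wordDist, wordLength_inv hX]
    have g2 : wordDist X 1 (k ^ i * y) = wordDist X y (k ^ i)⁻¹ := by
      rw [← wordDist_mul_left X (k ^ i) y, mul_inv_cancel, wordDist_comm hX]
    rw [g1, g2] at f3
    simp only [wordDist, inv_inv, mul_one, inv_one, one_mul, wordLength_inv hX, mul_assoc]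
      at f1 f2 f3 hdiff hs ⊢
    omega
  exact absurd (hx (x * y)) (by omega)

/-- Gromov: the nontrivial elements of a torsion-free hyperbolic group have stable length bounded
away from zero. -/
theorem FourPoint.exists_stableLength_ge {X : Finset G}
    (hX : Subgroup.closure (X : Set G) = ⊤) {D : ℕ}
    (h : FourPoint (X : Set G) D) (htf : IsTorsionFreeGroup G) :
    ∃ N : ℕ, 0 < N ∧ ∀ g : G, g ≠ 1 → 1 ≤ N * stableLength (X : Set G) g := by
  have hfin := finite_ball hX (8 * D + 4)
  refine ⟨(ball (X : Set G) (8 * D + 4)).ncard,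
    (Set.ncard_pos hfin).2 ⟨1, by simp [ball]⟩, fun g hg => ?_⟩
  set N := (ball (X : Set G) (8 * D + 4)).ncard
  by_contra! hlt
  -- The exponents `0, …, N` give `N + 1` distinct powers, one more than the ball can hold.
  obtain ⟨x, hx⟩ := h.exists_conj_pow_mem_ball hX (g := g) (N := N) fun i hi => by
    rw [stableLength_pow hX]
    have : (i : ℝ) ≤ N := by exact_mod_cast hi
    have := mul_le_mul_of_nonneg_right this (stableLength_nonneg hX g)
    linarith
  have hk : x⁻¹ * g * x ≠ 1 := by
    intro h1
    apply hg
    have : g = x * (x⁻¹ * g * x) * x⁻¹ := by group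
    rw [this, h1]; group
  have hinj : Function.Injective fun i : ℕ => (x⁻¹ * g * x) ^ i :=
    injective_pow_iff_not_isOfFinOrder.2 (htf _ hk)
  have hcard := Set.ncard_le_ncard (s := (fun i : ℕ => (x⁻¹ * g * x) ^ i) '' Set.Iic N)
    (t := ball (X : Set G) (8 * D + 4)) (by rintro _ ⟨i, hi, rfl⟩; exact hx i hi) hfin
  rw [Set.ncard_image_of_injective _ hinj, ← Finset.coe_Iic, Set.ncard_coe_finset,
    Nat.card_Iic] at hcard
  omega

/-- Abelian subgroups of torsion-free hyperbolic groups have linear growth, uniformly. -/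
theorem FourPoint.exists_card_le {X : Finset G}
    (hX : Subgroup.closure (X : Set G) = ⊤) {D : ℕ}
    (h : FourPoint (X : Set G) D) (htf : IsTorsionFreeGroup G) :
    ∃ N : ℕ, ∀ (S : Finset G) (T : ℕ), (∀ a ∈ S, ∀ b ∈ S, Commute a b) →
      (∀ a ∈ S, wordLength (X : Set G) a ≤ T) → S.card ≤ 2 * (N * T + 1) := by
  classical
  obtain ⟨N, hN, hmin⟩ := h.exists_stableLength_ge hX htf
  refine ⟨N, fun S T hS hT => ?_⟩
  rw [← Finset.card_range (N * T + 1)]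
  refine Finset.card_le_mul_card_image_of_maps_to
    (f := fun a => ⌊N * stableLength (X : Set G) a⌋₊) (fun a ha => ?_) 2 fun m _ => ?_
  · rw [Finset.mem_range, Nat.lt_succ_iff]
    refine Nat.floor_le_of_le ?_
    push_cast
    gcongr
    exact (stableLength_le hX a).trans (by exact_mod_cast hT a ha)
  · rcases Finset.eq_empty_or_nonempty
      (S.filter fun a => ⌊N * stableLength (X : Set G) a⌋₊ = m) with he | ⟨b, hb⟩
    · simp [he]
    -- Equal floors mean stable lengths within `1 / N`, so `a * b` or `a * b⁻¹` is trivial.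
    refine (Finset.card_le_card (t := {b, b⁻¹}) fun a ha => ?_).trans Finset.card_le_two
    rw [Finset.mem_filter] at ha hb
    have hmn := h.min_stableLength_le hX (hS a ha.1 b hb.1)
    have habs : N * |stableLength (X : Set G) a - stableLength (X : Set G) b| < 1 := by
      have na := stableLength_nonneg hX a
      have nb := stableLength_nonneg hX b
      have a1 := Nat.floor_le (show 0 ≤ N * stableLength (X : Set G) a by positivity)
      have b1 := Nat.floor_le (show 0 ≤ N * stableLength (X : Set G) b by positivity)
      have a2 := Nat.lt_floor_add_one (N * stableLength (X : Set G) a)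
      have b2 := Nat.lt_floor_add_one (N * stableLength (X : Set G) b)
      rw [ha.2] at a1 a2
      rw [hb.2] at b1 b2
      rw [← abs_of_nonneg (Nat.cast_nonneg (α := ℝ) N), ← abs_mul, mul_sub, abs_lt]
      constructor <;> linarith
    have hzero : ∀ c : G, stableLength (X : Set G) c ≤
        |stableLength (X : Set G) a - stableLength (X : Set G) b| → c = 1 := by
      intro c hc
      by_contra hne
      have := hmin c hne
      have := mul_le_mul_of_nonneg_left hc (Nat.cast_nonneg (α := ℝ) N)
      linarith
    simp only [Finset.mem_insert, Finset.mem_singleton]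
    rcases min_le_iff.1 hmn with hc | hc
    · exact .inr (eq_inv_of_mul_eq_one_left (hzero _ hc))
    · exact .inl (mul_inv_eq_one.1 (hzero _ hc))

end Displacement


/-! ### Discriminating homomorphisms and box sizes -/

section Complexity

variable {G H : Type*} [Group G] [Group H]

/-- Balls are finite, so some homomorphism discriminates and the `sInf` is attained rather than
being the default `0`. -/
theorem exists_hom_discriminatingComplexity {X : Finset G} (Y : Finset H)
    (hX : Subgroup.closure (X : Set G) = ⊤) (hG : IsFullyResidually G H) (R : ℕ) :
    ∃ φ : G →* H, Discriminates φ (ball (X : Set G) R \ {1}) ∧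
      homComplexity X Y φ = discriminatingComplexity X Y R := by
  obtain ⟨φ, hφ⟩ := hG (ball (X : Set G) R \ {1}) ((finite_ball hX R).sdiff) (by simp)
  exact Nat.sInf_mem (s := {k : ℕ | ∃ φ : G →* H, Discriminates φ (ball (X : Set G) R \ {1}) ∧
    homComplexity X Y φ = k}) ⟨_, φ, hφ, rfl⟩

theorem Discriminates.injOn {X : Set G} {R : ℕ} {φ : G →* H}
    (hφ : Discriminates φ (ball X R \ {1})) {g h : G} (hgh : wordLength X (g * h⁻¹) ≤ R)
    (he : φ g = φ h) : g = h := by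
  by_contra hne
  refine hφ (g * h⁻¹) ⟨hgh, fun h1 => hne (mul_inv_eq_one.1 h1)⟩ ?_
  rw [map_mul, map_inv, he, mul_inv_cancel]

/-- Word lengths in the image of `ℤᵐ` are linearly bounded by the sup norm. -/
theorem exists_wordLength_le_of_abs_le {X : Set G} (hX : Subgroup.closure X = ⊤) {m : ℕ}
    (f : Multiplicative (Fin m → ℤ) →* G) :
    ∃ L : ℕ, ∀ (R : ℕ) (v : Fin m → ℤ), (∀ i, |v i| ≤ R) →
      wordLength X (f (.ofAdd v)) ≤ L * R := by
  let ℓ : (Fin m → ℤ) → ℕ := fun v => wordLength X (f (.ofAdd v))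
  have hadd : ∀ v w, ℓ (v + w) ≤ ℓ v + ℓ w := fun v w => by
    simp only [ℓ, ofAdd_add, map_mul]
    exact wordLength_mul_le hX _ _
  have hnsmul : ∀ (k : ℕ) (v : Fin m → ℤ), ℓ (k • v) ≤ k * ℓ v := fun k v => by
    induction k with
    | zero => simp [ℓ]
    | succ k ih =>
      rw [succ_nsmul, add_mul, one_mul]
      exact (hadd _ _).trans (by omega)
  have hzsmul : ∀ (k : ℤ) (v : Fin m → ℤ), ℓ (k • v) ≤ k.natAbs * ℓ v := fun k v => by
    rcases Int.natAbs_eq k with h | h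
    · conv_lhs => rw [h, natCast_zsmul]
      exact hnsmul _ _
    · conv_lhs => rw [h, neg_smul, natCast_zsmul]
      have : ℓ (-(k.natAbs • v)) = ℓ (k.natAbs • v) := by
        simp only [ℓ, ofAdd_neg, map_inv, wordLength_inv hX]
      rw [this]
      exact hnsmul _ _
  refine ⟨∑ i, ℓ (Pi.single i 1), fun R v hv => ?_⟩
  have hsum : v = ∑ i, v i • (Pi.single i 1 : Fin m → ℤ) := by
    ext j
    simp [Finset.sum_apply, Pi.single_apply]
  calc wordLength X (f (.ofAdd v)) = ℓ (∑ i, v i • (Pi.single i 1 : Fin m → ℤ)) := by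
        rw [← hsum]
    _ ≤ ∑ i, ℓ (v i • (Pi.single i 1 : Fin m → ℤ)) :=
        Finset.le_sum_of_subadditive ℓ (by simp [ℓ]) hadd _ _
    _ ≤ ∑ i, ℓ (Pi.single i 1) * R := by
        refine Finset.sum_le_sum fun i _ => (hzsmul _ _).trans ?_
        rw [mul_comm]
        gcongr
        have := hv i
        rw [Int.abs_eq_natAbs] at this
        exact_mod_cast this
    _ = _ := by rw [Finset.sum_mul]

end Complexity

end LimitGroups

/-! ### The counting argument -/

theorem mainTheorem6 {Γ : Type*} [Group Γ] (hΓ : LimitGroups.IsHyperbolicGroup Γ)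
    (hΓtf : LimitGroups.IsTorsionFreeGroup Γ)
    {G : Type*} [Group G] (hG : LimitGroups.IsLimitGroup Γ G)
    (n : ℕ) (hA : LimitGroups.HasFreeAbelianSubgroupOfRank G (n + 1))
    (X : Finset G) (hX : LimitGroups.IsFiniteGeneratingSet X)
    (Y : Finset Γ) (hY : LimitGroups.IsFiniteGeneratingSet Y) :
    ∃ p : Polynomial ℕ, p.degree = (n : WithBot ℕ) ∧
      LimitGroups.AsymptoticallyDominatedBy (fun R => p.eval R)
        (LimitGroups.discriminatingComplexity X Y) := by
  classical
  obtain ⟨Z, hZ, δ, hδ⟩ := hΓ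
  obtain ⟨N, hN⟩ := (hδ.fourPoint hZ).exists_card_le hZ hΓtf
  obtain ⟨A, ⟨e⟩⟩ := hA
  let f : Multiplicative (Fin (n + 1) → ℤ) →* G := A.subtype.comp e.symm.toMonoidHom
  have hf : Function.Injective f := A.subtype_injective.comp e.symm.injective
  obtain ⟨L, hL⟩ := LimitGroups.exists_wordLength_le_of_abs_le hX f
  -- `c` converts lengths over `Y` into lengths over the hyperbolic generating set `Z`. In `K`, the
  -- summand `L` puts differences of box points into the ball; the rest absorbs the count.
  let c := LimitGroups.homComplexity Y Z (MonoidHom.id Γ)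
  let K := L + 2 * (N * (c * L) + 1)
  refine ⟨Polynomial.X ^ n, Polynomial.degree_X_pow n, K, fun R => ?_⟩
  obtain ⟨φ, hφ, hφC⟩ :=
    LimitGroups.exists_hom_discriminatingComplexity Y hX hG.2 (K * R)
  set C := LimitGroups.discriminatingComplexity X Y (K * R)
  let B : Finset (Fin (n + 1) → ℤ) := Fintype.piFinset fun _ => Finset.Icc (0 : ℤ) R
  have hB : ∀ v ∈ B, ∀ i, 0 ≤ v i ∧ v i ≤ R := fun v hv i => by
    simpa using Fintype.mem_piFinset.1 hv i
  have hBcard : B.card = (R + 1) ^ (n + 1) := by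
    simp [B, Fintype.card_piFinset]
  let F : (Fin (n + 1) → ℤ) → Γ := fun v => φ (f (.ofAdd v))
  have hinj : Set.InjOn F B := by
    intro v hv w hw hvw
    refine Multiplicative.ofAdd.injective (hf (hφ.injOn ?_ hvw))
    rw [← map_inv, ← map_mul, ← ofAdd_neg, ← ofAdd_add]
    refine (hL R _ fun i => ?_).trans (Nat.mul_le_mul_right R (Nat.le_add_right L _))
    have h1 := hB v hv i
    have h2 := hB w hw i
    rw [Pi.add_apply, Pi.neg_apply, abs_le]
    constructor <;> linarith
  have hcard := hN (B.image F) (c * (C * (L * R))) ?_ ?_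
  · rw [Finset.card_image_of_injOn hinj, hBcard] at hcard
    have h1 : (R + 1) ^ n * (R + 1) ≤ (K * C + K) * (R + 1) := by
      rw [← pow_succ]
      refine hcard.trans ?_
      have hK : K = L + 2 * (N * (c * L) + 1) := rfl
      rw [hK]
      -- The second summand is the nonnegative slack in the bound.
      have : 2 * (N * (c * (C * (L * R))) + 1) + (L * C * (R + 1) + 2 * (N * (c * L)) * C +
          2 * C * (R + 1) + L * (R + 1) + 2 * (N * (c * L)) * (R + 1) + 2 * R) =
          ((L + 2 * (N * (c * L) + 1)) * C + (L + 2 * (N * (c * L) + 1))) * (R + 1) := by ring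
      omega
    have h2 := Nat.le_of_mul_le_mul_right h1 (Nat.succ_pos R)
    simp only [Polynomial.eval_pow, Polynomial.eval_X]
    exact (Nat.pow_le_pow_left (Nat.le_succ R) n).trans h2
  · intro a ha b hb
    obtain ⟨v, -, rfl⟩ := Finset.mem_image.1 ha
    obtain ⟨w, -, rfl⟩ := Finset.mem_image.1 hb
    exact ((Commute.all (Multiplicative.ofAdd v) (Multiplicative.ofAdd w)).map f).map φ
  · intro a ha
    obtain ⟨v, hv, rfl⟩ := Finset.mem_image.1 ha
    refine (LimitGroups.wordLength_map_le hY hZ (MonoidHom.id Γ) (F v)).trans ?_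
    refine Nat.mul_le_mul_left c ((LimitGroups.wordLength_map_le hX hY φ _).trans ?_)
    rw [hφC]
    refine Nat.mul_le_mul_left C (hL R v fun i => ?_)
    have := hB v hv i
    rw [abs_le]
    constructor <;> linarith
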